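/- Let $\mathbb K$ be a field of characteristic zero, and let $\sigma_x,\sigma_y$ be the automorphisms of $\mathbb K(x,y)$ with $\sigma_x(f)(x,y)=f(x+1,y)$ and $\sigma_y(f)(x,y)=f(x,y+1)$. Let $\mathcal A=\mathbb K(x,y)[S_x,S_y,S_x^{-1},S_y^{-1}]$ be the ring of operators $\sum_{i,j\in\mathbb Z}a_{ij}S_x^iS_y^j$ (finite sums, $a_{ij}\in\mathbb K(x,y)$), in which $S_xS_y=S_yS_x$, $S_xf=\sigma_x(f)S_x$ and $S_yf=\sigma_y(f)S_y$ for $f\in\mathbb K(x,y)$. Operators are applied to rational functions by $\big(\sum a_{ij}S_x^iS_y^j\big)(f)=\sum a_{ij}\,\sigma_x^i\sigma_y^j(f)$. A nonzero $L\in\mathbb K[x][S_x]$ is a *telescoper* for $f\in\mathbb K(x,y)$ if $L(f)=(S_y-1)(g)$ for some $g\in\mathbb K(x,y)$; such a $g$ is called a corresponding *certificate* of $L$. For coprime integers $\lambda,\mu$ with $\mu>0$ let $\alpha,\beta$ be the unique integers with $\alpha\lambda+\beta\mu=1$ and $0\le\alpha<\mu$, and put $S_{\lambda,\mu}=S_x^{\alpha}S_y^{\beta}$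 and $\mathcal A_{\lambda,\mu}=\mathbb K(x,y)[S_{\lambda,\mu},S_{\lambda,\mu}^{-1}]\subseteq\mathcal A$. Let $\varphi_{\lambda,\mu}:\mathcal A\to\mathcal A_{\lambda,\mu}$ be the map $\sum a_{ij}S_x^iS_y^j\mapsto\sum a_{ij}S_{\lambda,\mu}^{i\lambda+j\mu}$, and for $L\in\mathcal A$, $M\in\mathcal A_{\lambda,\mu}$ put $L\odot M=\varphi_{\lambda,\mu}(LM)$. **Theorem.** Let $r\in\mathbb K(x,y)$ be a rational function of the form $$r=\sum_{i=1}^m\sum_{k=1}^{d_i}M_{ik}\left(\frac1{p_i(\lambda_ix+\mu_iy)^k}\right),$$ where $m,d_i\in\mathbb N$; each $(\lambda_i,\mu_i)$ is a pair of coprime integers with $\mu_i>0$; each $p_i\in\mathbb K[z]$ is monic and irreducible; each $M_{ik}\in\mathbb K(x)[y,S_{\lambda_i,\mu_i}]$ is a finite sum $\sum_{n\ge0}a_nS_{\lambda_i,\mu_i}^n$ with $a_n\in\mathbb K(x)[y]$ and $\deg_y a_n<\deg_z p_i$; and for $i\ne j$ there are no integers $\ell,n$ with $p_i(\lambda_ix+\mu_iy)=\sigma_x^{\ell}\sigma_y^{n}\big(p_j(\lambda_jx+\mu_jy)\big)$.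 Let $L\in\mathbb K[x][S_x]$ be nonzero. Then $L$ is a telescoper for $r$ if and only if, for all $i=1,\dots,m$ and $k=1,\dots,d_i$, there exists $Q_{ik}\in\mathcal A_{\lambda_i,\mu_i}$ such that $$L\odot M_{ik}=(S_y-1)\odot Q_{ik},$$ where $\odot$ is taken with respect to $(\lambda_i,\mu_i)$. Moreover, for any operators $Q_{ik}\in\mathcal A_{\lambda_i,\mu_i}$ satisfying these equations, a corresponding certificate of $L$ is $$\sum_{i=1}^m\sum_{k=1}^{d_i}Q_{ik}\left(\frac1{p_i(\lambda_ix+\mu_iy)^k}\right).$$ -/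

import Mathlib

namespace Telescoping

open Polynomial

noncomputable section

/-- The field `K(x,y)` of bivariate rational functions, realised as `K(x)(y)`. -/
abbrev BiRat (K : Type*) [Field K] : Type _ := RatFunc (RatFunc K)

section Shifts

variable (K : Type*) [Field K]

/-- The variable `x` of `K(x,y)`. -/
def xVar : BiRat K := RatFunc.C RatFunc.X

/-- The variable `y` of `K(x,y)`. -/
def yVar : BiRat K := RatFunc.X

/-- The automorphism `c(x) ↦ c(x+1)` of `K(x)`. -/
def shiftUni : RatFunc K ≃+* RatFunc K :=
  IsFractionRing.ringEquivOfRingEquiv (algEquivAevalXAddC (1 : K)).toRingEquiv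

/-- The automorphism `f(x,y) ↦ f(x+1,y)` of `K(x,y)`. -/
def sigmaX : RingAut (BiRat K) :=
  IsFractionRing.ringEquivOfRingEquiv (Polynomial.mapEquiv (shiftUni K))

/-- The automorphism `f(x,y) ↦ f(x,y+1)` of `K(x,y)`. -/
def sigmaY : RingAut (BiRat K) := shiftUni (RatFunc K)

variable {K}

theorem shiftUni_C (c : K) : shiftUni K (RatFunc.C c) = RatFunc.C c := by
  rw [← RatFunc.algebraMap_C, shiftUni, IsFractionRing.ringEquivOfRingEquiv_algebraMap]
  simp [algEquivAevalXAddC]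

theorem shiftUni_X : shiftUni K RatFunc.X = RatFunc.X + 1 := by
  rw [← RatFunc.algebraMap_X, shiftUni, IsFractionRing.ringEquivOfRingEquiv_algebraMap]
  simp [algEquivAevalXAddC]

theorem sigmaX_C (c : RatFunc K) : sigmaX K (RatFunc.C c) = RatFunc.C (shiftUni K c) := by
  rw [← RatFunc.algebraMap_C, ← RatFunc.algebraMap_C, sigmaX,
    IsFractionRing.ringEquivOfRingEquiv_algebraMap]
  simp

theorem sigmaX_yVar : sigmaX K (yVar K) = yVar K := by
  rw [yVar, ← RatFunc.algebraMap_X, sigmaX, IsFractionRing.ringEquivOfRingEquiv_algebraMap]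
  simp

theorem sigmaX_xVar : sigmaX K (xVar K) = xVar K + 1 := by
  rw [xVar, sigmaX_C, shiftUni_X, map_add, map_one]

theorem sigmaY_C (c : RatFunc K) : sigmaY K (RatFunc.C c) = RatFunc.C c := shiftUni_C c

theorem sigmaY_yVar : sigmaY K (yVar K) = yVar K + 1 := shiftUni_X

theorem sigma_commute : Commute (sigmaX K) (sigmaY K) := by
  have hpoly : ∀ q : (RatFunc K)[X],
      sigmaX K (sigmaY K (algebraMap _ _ q)) = sigmaY K (sigmaX K (algebraMap _ _ q)) := by
    intro q
    induction q using Polynomial.induction_on' with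
    | add a b ha hb => simp only [map_add, ha, hb]
    | monomial n a =>
      rw [← Polynomial.C_mul_X_pow_eq_monomial]
      simp only [map_mul, map_pow, RatFunc.algebraMap_C, RatFunc.algebraMap_X]
      have hy : sigmaX K (RatFunc.X) = RatFunc.X := sigmaX_yVar
      have hy' : sigmaY K (RatFunc.X) = RatFunc.X + 1 := sigmaY_yVar
      simp only [sigmaX_C, sigmaY_C, hy, hy', map_add, map_one]
  refine RingEquiv.ext fun f => ?_
  change sigmaX K (sigmaY K f) = sigmaY K (sigmaX K f)
  obtain ⟨a, b, -, rfl⟩ := IsFractionRing.div_surjective (A := (RatFunc K)[X]) f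
  simp only [map_div₀, hpoly]

end Shifts

/-- The group of monomials `S_x^i S_y^j`, `i, j ∈ ℤ`, written multiplicatively. -/
abbrev ShiftGroup : Type := Multiplicative (ℤ × ℤ)

/-- The monomial `S_x^i S_y^j`. -/
def mon (i j : ℤ) : ShiftGroup := Multiplicative.ofAdd (i, j)

/-- The action of monomials on `K(x,y)`: `S_x^i S_y^j` acts as `σ_x^i σ_y^j`. -/
def shiftHom (K : Type*) [Field K] : ShiftGroup →* RingAut (BiRat K) where
  toFun s := sigmaX K ^ s.toAdd.1 * sigmaY K ^ s.toAdd.2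
  map_one' := by simp
  map_mul' s t := by
    have h := (sigma_commute (K := K)).zpow_zpow t.toAdd.1 s.toAdd.2
    simp only [toAdd_mul, Prod.fst_add, Prod.snd_add, zpow_add]
    rw [mul_assoc, mul_assoc, ← mul_assoc (sigmaX K ^ t.toAdd.1), h.eq, mul_assoc]

instance shiftAction (K : Type*) [Field K] : MulSemiringAction ShiftGroup (BiRat K) :=
  MulSemiringAction.compHom (BiRat K) (shiftHom K)

/-- The ring `𝒜 = K(x,y)[S_x, S_y, S_x⁻¹, S_y⁻¹]` of recurrence operators `∑ a_ij S_x^i S_y^j`,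
the skew group ring whose multiplication is `(a s) (b t) = a s(b) (s t)` for monomials `s, t`. -/
abbrev Op (K : Type*) [Field K] : Type _ := SkewMonoidAlgebra (BiRat K) ShiftGroup

section Operators

variable {K : Type*} [Field K]

/-- The application `L(f) = ∑ a_ij σ_x^i σ_y^j(f)` of an operator to a rational function. -/
def app (L : Op K) (f : BiRat K) : BiRat K := L.sum fun s a => a * shiftHom K s f

/-- The operator `S_y`. -/
def Sy : Op K := SkewMonoidAlgebra.single (mon 0 1) 1

variable (K) in
/-- The subset `K[x][S_x]` of `𝒜`. -/
def polyOpX : Set (Op K) :=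
  {L | ∀ s ∈ L.support, (∃ n : ℕ, s = mon n 0) ∧
    ∃ c : K[X], L.coeff s = RatFunc.C (algebraMap K[X] (RatFunc K) c)}

/-- `g` is a certificate for `L` with respect to `f`: `L(f) = (S_y - 1)(g)`. -/
def IsCertificate (L : Op K) (f g : BiRat K) : Prop := app L f = app (Sy - 1) g

/-- `L` is a telescoper for `f`: it is a nonzero element of `K[x][S_x]` that has a certificate. -/
def IsTelescoper (L : Op K) (f : BiRat K) : Prop :=
  L ∈ polyOpX K ∧ L ≠ 0 ∧ ∃ g : BiRat K, IsCertificate L f g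

/-- The rational function `p(λx + μy)`. -/
def evalLin (p : K[X]) (lam mu : ℤ) : BiRat K :=
  p.eval₂ (RatFunc.C.comp RatFunc.C) (lam * xVar K + mu * yVar K)

/-- Shift-equivalence with respect to `x, y`. -/
def ShiftEquiv (f g : BiRat K) : Prop :=
  ∃ l n : ℤ, f = (sigmaX K ^ l) ((sigmaY K ^ n) g)

end Operators

section IntegerLinear

/-- The coefficient `α` of the Bézout relation `αλ + βμ = 1` with `0 ≤ α < μ`, for coprime `λ, μ`
with `μ > 0`. Such a pair `(α, β)` is unique; it is `(0, 1)` if `λ = 0`. -/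
def bezA (lam mu : ℤ) : ℤ := Int.gcdA lam mu % mu

/-- The coefficient `β` of the Bézout relation `αλ + βμ = 1` with `0 ≤ α < μ`. -/
def bezB (lam mu : ℤ) : ℤ := (1 - bezA lam mu * lam) / mu

theorem bezout {lam mu : ℤ} (h : IsCoprime lam mu) :
    bezA lam mu * lam + bezB lam mu * mu = 1 := by
  have hg : (Int.gcd lam mu : ℤ) = 1 := by rw [Int.isCoprime_iff_gcd_eq_one.mp h]; rfl
  have h1 := Int.gcd_eq_gcd_ab lam mu
  rw [hg] at h1
  have h2 : mu ∣ 1 - bezA lam mu * lam := by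
    refine ⟨Int.gcdB lam mu + Int.gcdA lam mu / mu * lam, ?_⟩
    have h3 := Int.mul_ediv_add_emod (Int.gcdA lam mu) mu
    rw [bezA]
    linear_combination h1 - lam * h3
  rw [bezB, Int.ediv_mul_cancel h2]
  ring

theorem bezA_bounds (lam : ℤ) {mu : ℤ} (hmu : 0 < mu) : 0 ≤ bezA lam mu ∧ bezA lam mu < mu :=
  ⟨Int.emod_nonneg _ hmu.ne', Int.emod_lt_of_pos _ hmu⟩

variable {K : Type*} [Field K]

/-- The monomial `S_{λ,μ} = S_x^α S_y^β`. -/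
def lmMon (lam mu : ℤ) : ShiftGroup := mon (bezA lam mu) (bezB lam mu)

variable (K) in
/-- The subset `𝒜_{λ,μ} = K(x,y)[S_{λ,μ}, S_{λ,μ}⁻¹]` of `𝒜`, which consists of the operators
`∑ a_n S_{λ,μ}^n`, `n ∈ ℤ`. -/
def lmOp (lam mu : ℤ) : Set (Op K) :=
  {M | ∀ s ∈ M.support, ∃ n : ℤ, s = lmMon lam mu ^ n}

variable (K) in
/-- The operators in `K(x)[y, S_{λ,μ}]` with `deg_y < d`: the sums `∑ a_n S_{λ,μ}^n`, `n ∈ ℕ`,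
whose coefficients `a_n ∈ K(x)[y]` have degree less than `d` in `y`. -/
def lmPolyOp (lam mu : ℤ) (d : ℕ) : Set (Op K) :=
  {M | ∀ s ∈ M.support, (∃ n : ℕ, s = lmMon lam mu ^ n) ∧
    ∃ a : (RatFunc K)[X], a.degree < d ∧ M.coeff s = algebraMap (RatFunc K)[X] (BiRat K) a}

/-- The left `K(x,y)`-linear map `φ_{λ,μ} : 𝒜 → 𝒜_{λ,μ}` that sends `∑ a_ij S_x^i S_y^j` to
`∑ a_ij S_{λ,μ}^(iλ+jμ)`. -/
def lmPhi (lam mu : ℤ) (L : Op K) : Op K :=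
  L.sum fun s a =>
    SkewMonoidAlgebra.single (lmMon lam mu ^ (s.toAdd.1 * lam + s.toAdd.2 * mu)) a

/-- The scalar multiplication `L ⊙ M = φ_{λ,μ}(L M)` of `𝒜` on `𝒜_{λ,μ}`. -/
def dot (lam mu : ℤ) (L M : Op K) : Op K := lmPhi lam mu (L * M)

end IntegerLinear

end

end Telescoping

/-! The monomial S_x^i S_y^j sends p(λx+μy) to p(λx+μy+iλ+jμ), so its effect depends only on the
weight iλ+jμ. Hence φ_{λ,μ} does not change the value of an operator on 1/p(λx+μy)^k (`app_lmPhi`),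
and L(r) is the sum of the (L⊙M_ik)(1/p_i(λ_i x+μ_i y)^k). With the equations for the Q_ik, the same
fact turns this sum into (S_y-1)(g), which gives the certificate and one implication.

For the other implication, work with rational functions in y over K(x). The coefficients of L⊙M_ik
still have y-degree below deg p_i (`coeff_dot_mem_lowDegree`), and the denominators p_i(λ_i x+μ_i
y+n) are irreducible and pairwise non-associated (`irreducible_linPoly`, `associated_linPoly`,
`linPoly_injective`). The expression for L(r) is therefore its partial fraction decomposition, and
uniqueness recovers every coefficient of L⊙M_ik from L(r) (`fracCoeff_app_self`). If L(r) = σ_y(g) -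
g, let the coefficient of S_{λ,μ}^n in Q_ik be the numerator of g over p_i(λ_i x+μ_i y+n)^k. Since
σ_y carries the denominator with index n-μ to that with index n (`fracCoeff_shift`), comparing
numerators is exactly L⊙M_ik = (S_y-1)⊙Q_ik. -/

namespace Telescoping

open Polynomial

noncomputable section

/-! ### Existence and uniqueness of partial fractions in one variable. -/

section PartialFractions

variable {F : Type*} [Field F]

/-- `P + ∑ c (q, j) / q ^ (j + 1)` is the partial fraction decomposition of `f`. -/
def IsPartialFraction (f : RatFunc F) (P : F[X]) (c : F[X] × ℕ →₀ F[X]) : Prop :=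
  (∀ t ∈ c.support, t.1.Monic ∧ Irreducible t.1 ∧ (c t).degree < t.1.degree) ∧
    f = algebraMap F[X] (RatFunc F) P +
      c.sum fun t a => algebraMap F[X] (RatFunc F) a / algebraMap F[X] (RatFunc F) t.1 ^ (t.2 + 1)

namespace IsPartialFraction

theorem sub {f f' : RatFunc F} {P P' : F[X]} {c c' : F[X] × ℕ →₀ F[X]}
    (h : IsPartialFraction f P c) (h' : IsPartialFraction f' P' c') :
    IsPartialFraction (f - f') (P - P') (c - c') := by
  classical
  refine ⟨fun t ht => ?_, ?_⟩
  · have h1 : t.1.Monic ∧ Irreducible t.1 := by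
      rcases Finset.mem_union.mp (Finsupp.support_sub ht) with h2 | h2
      · exact ⟨(h.1 t h2).1, (h.1 t h2).2.1⟩
      · exact ⟨(h'.1 t h2).1, (h'.1 t h2).2.1⟩
    refine ⟨h1.1, h1.2, ?_⟩
    -- An index may lie in only one of the two supports; the other numerator is then 0, of degree ⊥,
    -- and the bound persists.
    have key : ∀ {g P} {e : F[X] × ℕ →₀ F[X]}, IsPartialFraction g P e →
        (e t).degree < t.1.degree := by
      intro g P e he
      by_cases hz : e t = 0
      · rw [hz, degree_zero]
        exact bot_lt_iff_ne_bot.mpr (degree_ne_bot.mpr h1.1.ne_zero)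
      · exact (he.1 t (Finsupp.mem_support_iff.mpr hz)).2.2
    exact (degree_sub_le _ _).trans_lt (max_lt (key h) (key h'))
  · rw [Finsupp.sum_sub_index, h.2, h'.2, map_sub]
    · ring
    · intro t a b
      rw [map_sub, sub_div]

theorem zero : IsPartialFraction (0 : RatFunc F) 0 0 := ⟨by simp, by simp⟩

theorem add {f f' : RatFunc F} {P P' : F[X]} {c c' : F[X] × ℕ →₀ F[X]}
    (h : IsPartialFraction f P c) (h' : IsPartialFraction f' P' c') :
    IsPartialFraction (f + f') (P + P') (c + c') := by
  simpa using h.sub (zero.sub h')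

theorem of_polynomial (P : F[X]) : IsPartialFraction (algebraMap F[X] (RatFunc F) P) P 0 :=
  ⟨by simp, by simp⟩

theorem single {q a : F[X]} (hm : q.Monic) (hq : Irreducible q) (ha : a.degree < q.degree) (j : ℕ) :
    IsPartialFraction (algebraMap F[X] (RatFunc F) a /
      algebraMap F[X] (RatFunc F) q ^ (j + 1)) 0 (Finsupp.single (q, j) a) := by
  classical
  refine ⟨fun t ht => ?_, ?_⟩
  · obtain rfl := Finset.mem_singleton.mp (Finsupp.support_single_subset ht)
    exact ⟨hm, hq, by simpa using ha⟩
  · rw [Finsupp.sum_single_index (by simp)]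
    simp

theorem exists_sum {ι : Type*} (s : Finset ι) (f : ι → RatFunc F)
    (h : ∀ i ∈ s, ∃ P c, IsPartialFraction (f i) P c) :
    ∃ P c, IsPartialFraction (∑ i ∈ s, f i) P c := by
  classical
  induction s using Finset.induction_on with
  | empty => exact ⟨0, 0, by simpa using zero⟩
  | insert i s hi ih =>
    obtain ⟨P, c, hP⟩ := h i (Finset.mem_insert_self i s)
    obtain ⟨P', c', hP'⟩ := ih fun j hj => h j (Finset.mem_insert_of_mem hj)
    exact ⟨P + P', c + c', by rw [Finset.sum_insert hi]; exact hP.add hP'⟩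

end IsPartialFraction

theorem isCoprime_of_monic_irreducible {p q : F[X]} (hp : p.Monic) (hq : q.Monic)
    (hpi : Irreducible p) (hqi : Irreducible q) (h : p ≠ q) : IsCoprime p q := by
  refine (hpi.isCoprime_or_dvd q).resolve_right fun hd => h ?_
  exact eq_of_monic_of_associated hp hq (hpi.associated_of_dvd hqi hd)

theorem exists_isPartialFraction (f : RatFunc F) : ∃ P c, IsPartialFraction f P c := by
  classical
  obtain ⟨a, b, hb, rfl⟩ := IsFractionRing.div_surjective (A := F[X]) f
  have hb0 : b ≠ 0 := nonZeroDivisors.ne_zero hb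
  set s := (UniqueFactorizationMonoid.normalizedFactors b).toFinset with hs
  set n : F[X] → ℕ := fun q => (UniqueFactorizationMonoid.normalizedFactors b).count q with hn
  have hsm : ∀ q ∈ s, q.Monic := fun q hq => by
    have hq' := Multiset.mem_toFinset.mp hq
    rw [← UniqueFactorizationMonoid.normalize_normalized_factor q hq']
    exact monic_normalize (UniqueFactorizationMonoid.irreducible_of_normalized_factor q hq').ne_zero
  have hsi : ∀ q ∈ s, Irreducible q := fun q hq =>
    UniqueFactorizationMonoid.irreducible_of_normalized_factor q (Multiset.mem_toFinset.mp hq)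
  obtain ⟨u, hu⟩ := UniqueFactorizationMonoid.prod_normalizedFactors hb0
  rw [Finset.prod_multiset_count] at hu
  -- The normalized factors give `b` only up to a unit, which is absorbed into the numerator.
  have hsp : ∏ q ∈ s, q ^ n q = b * ↑u⁻¹ := by rw [← hu]; simp [hs, hn]
  obtain ⟨P, r, hr, h⟩ := mul_prod_pow_inverse_eq_quo_add_sum_rem_mul_pow_inverse (s := s)
    (K := RatFunc F) (a * (↑u⁻¹ : F[X])) (g := id) hsm
    (fun p hp q hq hpq =>
      isCoprime_of_monic_irreducible (hsm p hp) (hsm q hq) (hsi p hp) (hsi q hq) hpq) n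
    (gi := fun q => (algebraMap F[X] (RatFunc F) q)⁻¹)
    (fun q hq => inv_mul_cancel₀ (by simpa using (hsi q hq).ne_zero))
  have hf : algebraMap F[X] (RatFunc F) a / algebraMap F[X] (RatFunc F) b =
      algebraMap F[X] (RatFunc F) (a * ↑u⁻¹) *
        ∏ q ∈ s, (algebraMap F[X] (RatFunc F) q)⁻¹ ^ n q := by
    have hu0 : algebraMap F[X] (RatFunc F) ↑u⁻¹ ≠ 0 := by simp
    have hb0' : algebraMap F[X] (RatFunc F) b ≠ 0 := by simpa using hb0
    simp only [inv_pow, Finset.prod_inv_distrib, ← map_pow, ← map_prod, hsp]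
    simp only [map_mul]
    field_simp
  rw [hf, h]
  obtain ⟨P', c', h'⟩ := IsPartialFraction.exists_sum s
    (fun q => ∑ j, algebraMap F[X] (RatFunc F) (r q j) *
      (algebraMap F[X] (RatFunc F) q)⁻¹ ^ (j.1 + 1))
    fun q hq => IsPartialFraction.exists_sum Finset.univ _ fun j _ =>
      ⟨0, _, by simpa [div_eq_mul_inv] using
        IsPartialFraction.single (hsm q hq) (hsi q hq) (hr q hq j) j.1⟩
  exact ⟨P + P', 0 + c', (IsPartialFraction.of_polynomial P).add h'⟩

/-- The uniqueness result compares families with prescribed exponent ranges, so the support is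
enlarged to a rectangle (primes times one common range) and compared with the zero family. -/
theorem IsPartialFraction.eq_zero {P : F[X]} {c : F[X] × ℕ →₀ F[X]}
    (h : IsPartialFraction 0 P c) : c = 0 := by
  classical
  set s := c.support.image Prod.fst with hs
  set N := c.support.sup Prod.snd + 1 with hN
  have hsub : c.support ⊆ s ×ˢ Finset.range N := fun t ht => by
    rw [Finset.mem_product, Finset.mem_range]
    exact ⟨Finset.mem_image_of_mem _ ht, Nat.lt_succ_of_le (Finset.le_sup (f := Prod.snd) ht)⟩
  have hmem : ∀ q ∈ s, q.Monic ∧ Irreducible q := fun q hq => by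
    obtain ⟨t, ht, rfl⟩ := Finset.mem_image.mp hq
    exact ⟨(h.1 t ht).1, (h.1 t ht).2.1⟩
  have hdeg : ∀ q ∈ s, ∀ j, (c (q, j)).degree < q.degree := fun q hq j => by
    by_cases hz : c (q, j) = 0
    · rw [hz, degree_zero]
      exact bot_lt_iff_ne_bot.mpr (degree_ne_bot.mpr (hmem q hq).1.ne_zero)
    · exact (h.1 (q, j) (Finsupp.mem_support_iff.mpr hz)).2.2
  have h2 := h.2
  rw [Finsupp.sum_of_support_subset _ hsub _ (by simp), Finset.sum_product] at h2
  have := quo_add_sum_rem_mul_pow_inverse_unique (s := s) (K := RatFunc F) (g := id)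
    (fun q hq => (hmem q hq).1)
    (fun p hp q hq hpq => isCoprime_of_monic_irreducible (hmem p hp).1 (hmem q hq).1
      (hmem p hp).2 (hmem q hq).2 hpq) (n := fun _ => N)
    (gi := fun q => (algebraMap F[X] (RatFunc F) q)⁻¹)
    (fun q hq => inv_mul_cancel₀ (by simpa using (hmem q hq).1.ne_zero))
    (q₁ := P) (q₂ := 0) (r₁ := fun q j => c (q, j)) (r₂ := fun _ _ => 0)
    (fun q hq j => hdeg q hq j)
    (fun q hq j => by
      rw [degree_zero]
      exact bot_lt_iff_ne_bot.mpr (degree_ne_bot.mpr (hmem q hq).1.ne_zero))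
    (by
      simp only [Finset.sum_range] at h2
      simpa [div_eq_mul_inv] using h2.symm)
  ext1 t
  by_contra ht
  have ht' : t ∈ c.support := Finsupp.mem_support_iff.mpr ht
  have h3 := hsub ht'
  rw [Finset.mem_product, Finset.mem_range] at h3
  exact ht (congrFun (this.2 t.1 h3.1) ⟨t.2, h3.2⟩)

/-- Only the numerators are compared: the polynomial part plays no role in what follows. -/
theorem IsPartialFraction.unique {f : RatFunc F} {P P' : F[X]} {c c' : F[X] × ℕ →₀ F[X]}
    (h : IsPartialFraction f P c) (h' : IsPartialFraction f P' c') : c = c' := by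
  have := h.sub h'
  rw [sub_self] at this
  exact sub_eq_zero.mp this.eq_zero

/-- The family of numerators in the partial fraction decomposition of `f`. -/
def numerators (f : RatFunc F) : F[X] × ℕ →₀ F[X] := (exists_isPartialFraction f).choose_spec.choose

theorem exists_isPartialFraction_numerators (f : RatFunc F) :
    ∃ P, IsPartialFraction f P (numerators f) :=
  ⟨_, (exists_isPartialFraction f).choose_spec.choose_spec⟩

theorem IsPartialFraction.numerators_eq {f : RatFunc F} {P : F[X]} {c : F[X] × ℕ →₀ F[X]}
    (h : IsPartialFraction f P c) : numerators f = c :=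
  (exists_isPartialFraction_numerators f).choose_spec.unique h

theorem numerators_add (f g : RatFunc F) : numerators (f + g) = numerators f + numerators g := by
  obtain ⟨P, hP⟩ := exists_isPartialFraction_numerators f
  obtain ⟨Q, hQ⟩ := exists_isPartialFraction_numerators g
  exact (hP.add hQ).numerators_eq

/-! ### Numerators over irreducible denominators that need not be monic. -/

/-- The monic associate of a nonzero polynomial. -/
def monicPart (q : F[X]) : F[X] := q * C q.leadingCoeff⁻¹

theorem monicPart_monic {q : F[X]} (hq : q ≠ 0) : (monicPart q).Monic :=
  monic_mul_leadingCoeff_inv hq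

theorem associated_monicPart {q : F[X]} (hq : q ≠ 0) : Associated q (monicPart q) :=
  ⟨(isUnit_C.mpr (isUnit_iff_ne_zero.mpr (inv_ne_zero (leadingCoeff_ne_zero.mpr hq)))).unit, rfl⟩

theorem monicPart_eq_iff {p q : F[X]} (hp : p ≠ 0) (hq : q ≠ 0) :
    monicPart p = monicPart q ↔ Associated p q := by
  constructor
  · intro h
    exact (associated_monicPart hp).trans (h ▸ (associated_monicPart hq).symm)
  · intro h
    exact eq_of_monic_of_associated (monicPart_monic hp) (monicPart_monic hq)
      ((associated_monicPart hp).symm.trans (h.trans (associated_monicPart hq)))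

theorem degree_monicPart {q : F[X]} (hq : q ≠ 0) : (monicPart q).degree = q.degree :=
  (degree_eq_degree_of_associated (associated_monicPart hq)).symm

/-- The coefficient of `1 / q ^ (j + 1)` in the partial fraction decomposition, for an irreducible
polynomial `q` that need not be monic. -/
def fracCoeff (q : F[X]) (j : ℕ) : RatFunc F →+ RatFunc F where
  toFun f := RatFunc.C q.leadingCoeff ^ (j + 1) *
    algebraMap F[X] (RatFunc F) (numerators f (monicPart q, j))
  map_zero' := by simp [IsPartialFraction.zero.numerators_eq]
  map_add' f g := by rw [numerators_add, Finsupp.add_apply, map_add, mul_add]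

theorem fracCoeff_apply (q : F[X]) (j : ℕ) (f : RatFunc F) :
    fracCoeff q j f = RatFunc.C q.leadingCoeff ^ (j + 1) *
      algebraMap F[X] (RatFunc F) (numerators f (monicPart q, j)) := rfl

/-- Making `q` monic rescales the numerator by the inverse power of its leading coefficient; the
prefactor in `fracCoeff` undoes this. -/
theorem numerators_div_pow {q a : F[X]} (hq : Irreducible q) (ha : a.degree < q.degree) (j : ℕ) :
    numerators (algebraMap F[X] (RatFunc F) a / algebraMap F[X] (RatFunc F) q ^ (j + 1)) =
      Finsupp.single (monicPart q, j) (C (q.leadingCoeff⁻¹ ^ (j + 1)) * a) := by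
  have hlc : q.leadingCoeff ≠ 0 := leadingCoeff_ne_zero.mpr hq.ne_zero
  have h := IsPartialFraction.single (monicPart_monic hq.ne_zero)
    ((associated_monicPart hq.ne_zero).irreducible hq)
    (a := C (q.leadingCoeff⁻¹ ^ (j + 1)) * a)
    (by rwa [degree_monicPart hq.ne_zero, degree_C_mul (pow_ne_zero _ (inv_ne_zero hlc))]) j
  rw [← h.numerators_eq]
  congr 1
  have hq0 : algebraMap F[X] (RatFunc F) q ≠ 0 := by simpa using hq.ne_zero
  have hl0 : RatFunc.C q.leadingCoeff ≠ 0 := by simpa using hlc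
  rw [monicPart]
  simp only [map_mul, RatFunc.algebraMap_C, map_pow, map_inv₀, mul_pow]
  field_simp

theorem fracCoeff_div_pow_self {q a : F[X]} (hq : Irreducible q) (ha : a.degree < q.degree)
    (j : ℕ) : fracCoeff q j
      (algebraMap F[X] (RatFunc F) a / algebraMap F[X] (RatFunc F) q ^ (j + 1)) =
        algebraMap F[X] (RatFunc F) a := by
  have hl0 : RatFunc.C q.leadingCoeff ≠ 0 := by simpa using hq.ne_zero
  rw [fracCoeff_apply, numerators_div_pow hq ha, Finsupp.single_eq_same]
  simp only [map_mul, RatFunc.algebraMap_C, map_pow, map_inv₀]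
  rw [← mul_assoc, ← mul_pow, mul_inv_cancel₀ hl0, one_pow, one_mul]

theorem fracCoeff_div_pow_of_ne {q q' a : F[X]} (hq : q ≠ 0) (hq' : Irreducible q')
    (ha : a.degree < q'.degree) {j j' : ℕ} (h : ¬ (Associated q q' ∧ j = j')) : fracCoeff q j
      (algebraMap F[X] (RatFunc F) a / algebraMap F[X] (RatFunc F) q' ^ (j' + 1)) = 0 := by
  rw [fracCoeff_apply, numerators_div_pow hq' ha, Finsupp.single_eq_of_ne, map_zero, mul_zero]
  intro he
  rw [Prod.mk.injEq, monicPart_eq_iff hq hq'.ne_zero] at he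
  exact h he

/-- A rational function has finitely many poles, and non-associated `q i` have distinct monic parts.
This makes the operator built from the numerators of g a finite sum. -/
theorem finite_fracCoeff_ne_zero {ι : Type*} (q : ι → F[X]) (hq : ∀ i, q i ≠ 0)
    (hassoc : ∀ i i', Associated (q i) (q i') → i = i') (j : ℕ) (f : RatFunc F) :
    {i | fracCoeff (q i) j f ≠ 0}.Finite := by
  refine Set.Finite.of_finite_image (f := fun i => (monicPart (q i), j)) ?_ ?_
  · refine (numerators f).support.finite_toSet.subset ?_
    rintro - ⟨i, hi, rfl⟩
    rw [Finset.mem_coe, Finsupp.mem_support_iff]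
    intro h0
    exact hi (by rw [fracCoeff_apply, h0, map_zero, mul_zero])
  · intro i _ i' _ h
    rw [Prod.mk.injEq, monicPart_eq_iff (hq i) (hq i')] at h
    exact hassoc i i' h.1

/-! ### Partial fractions under the shift y ↦ y+1. -/

/-- The automorphism `a(y) ↦ a(y+1)` of polynomials. -/
def shiftPoly (F : Type*) [Field F] : F[X] ≃+* F[X] := (algEquivAevalXAddC (1 : F)).toRingEquiv

theorem shiftPoly_apply (a : F[X]) : shiftPoly F a = a.comp (X + C 1) := by
  simp [shiftPoly, algEquivAevalXAddC, comp, aeval_def, eval₂_eq_eval_map]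

theorem shiftUni_algebraMap (a : F[X]) :
    shiftUni F (algebraMap F[X] (RatFunc F) a) = algebraMap F[X] (RatFunc F) (shiftPoly F a) := by
  rw [shiftUni, IsFractionRing.ringEquivOfRingEquiv_algebraMap]
  rfl

theorem natDegree_shiftPoly (a : F[X]) : (shiftPoly F a).natDegree = a.natDegree := by
  rw [shiftPoly_apply, natDegree_comp, natDegree_X_add_C, mul_one]

theorem degree_shiftPoly (a : F[X]) : (shiftPoly F a).degree = a.degree := by
  by_cases h : a = 0
  · simp [h]
  · rw [degree_eq_natDegree h, degree_eq_natDegree (by simpa using h), natDegree_shiftPoly]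

theorem leadingCoeff_shiftPoly (a : F[X]) : (shiftPoly F a).leadingCoeff = a.leadingCoeff := by
  rw [shiftPoly_apply, leadingCoeff_comp (by rw [natDegree_X_add_C]; exact one_ne_zero),
    leadingCoeff_X_add_C, one_pow, mul_one]

theorem monicPart_shiftPoly (a : F[X]) : monicPart (shiftPoly F a) = shiftPoly F (monicPart a) := by
  rw [monicPart, monicPart, map_mul, leadingCoeff_shiftPoly, shiftPoly_apply (C _), C_comp]

/-- The shift permutes the monic irreducible polynomials and preserves degrees, so it carries a
decomposition term by term to a decomposition. -/
theorem IsPartialFraction.shift {f : RatFunc F} {P : F[X]} {c : F[X] × ℕ →₀ F[X]}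
    (h : IsPartialFraction f P c) :
    IsPartialFraction (shiftUni F f) (shiftPoly F P)
      ((c.equivMapDomain ((shiftPoly F).toEquiv.prodCongr (Equiv.refl ℕ))).mapRange
        (shiftPoly F) (map_zero _)) := by
  constructor
  · rintro ⟨q, j⟩ ht
    rw [Finsupp.mem_support_iff] at ht
    obtain ⟨q, rfl⟩ := (shiftPoly F).surjective q
    simp only [Finsupp.mapRange_apply, Finsupp.equivMapDomain_apply, Equiv.prodCongr_symm,
      Equiv.prodCongr_apply, Prod.map_apply, Equiv.refl_symm, Equiv.refl_apply,
      RingEquiv.toEquiv_eq_coe, ne_eq, EmbeddingLike.map_eq_zero_iff] at ht ⊢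
    have hs : (((shiftPoly F : F[X] ≃+* F[X]) : F[X] ≃ F[X]).symm) (shiftPoly F q) = q :=
      (shiftPoly F).symm_apply_apply q
    rw [hs] at ht ⊢
    obtain ⟨h1, h2, h3⟩ := h.1 (q, j) (Finsupp.mem_support_iff.mpr ht)
    refine ⟨?_, ?_, ?_⟩
    · rw [Monic, leadingCoeff_shiftPoly]
      exact h1
    · exact (MulEquiv.irreducible_iff (shiftPoly F)).mpr h2
    · rw [degree_shiftPoly, degree_shiftPoly]
      exact h3
  · rw [Finsupp.sum_mapRange_index (by simp), Finsupp.sum_equivMapDomain, h.2, map_add,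
      shiftUni_algebraMap, Finsupp.sum, Finsupp.sum, map_sum]
    congr 1
    refine Finset.sum_congr rfl fun t _ => ?_
    simp only [map_div₀, map_pow, shiftUni_algebraMap]
    rfl

theorem fracCoeff_shift (q : F[X]) (j : ℕ) (f : RatFunc F) :
    fracCoeff (shiftPoly F q) j (shiftUni F f) = shiftUni F (fracCoeff q j f) := by
  obtain ⟨P, hP⟩ := exists_isPartialFraction_numerators f
  rw [fracCoeff_apply, fracCoeff_apply, hP.shift.numerators_eq, leadingCoeff_shiftPoly,
    monicPart_shiftPoly, map_mul, map_pow, shiftUni_C, shiftUni_algebraMap]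
  congr 2
  rw [Finsupp.mapRange_apply, Finsupp.equivMapDomain_apply]
  congr 2
  exact Prod.ext ((shiftPoly F).symm_apply_apply _) rfl

end PartialFractions

/-! ### The denominators p(λx+μy+n) as polynomials in y over K(x). -/

section LinearForms

variable {K : Type*} [Field K]

/-- The polynomial `p(λx + μy + n)` in `y` over `K(x)`. -/
def linPoly (p : K[X]) (lam mu n : ℤ) : (RatFunc K)[X] :=
  (p.map RatFunc.C).comp (C (mu : RatFunc K) * X + C ((lam : RatFunc K) * (RatFunc.X : RatFunc K) + (n : RatFunc K)))

theorem algebraMap_linPoly (p : K[X]) (lam mu n : ℤ) :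
    algebraMap (RatFunc K)[X] (BiRat K) (linPoly p lam mu n) =
      p.eval₂ ((RatFunc.C : RatFunc K →+* BiRat K).comp RatFunc.C)
        ((lam : BiRat K) * xVar K + (mu : BiRat K) * yVar K + (n : BiRat K)) := by
  rw [linPoly, comp, hom_eval₂, eval₂_map]
  congr 1
  simp only [map_add, map_mul, RatFunc.algebraMap_C, RatFunc.algebraMap_X, map_intCast, xVar, yVar]
  ring

theorem evalLin_eq_algebraMap (p : K[X]) (lam mu : ℤ) :
    evalLin p lam mu = algebraMap (RatFunc K)[X] (BiRat K) (linPoly p lam mu 0) := by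
  rw [algebraMap_linPoly, evalLin, Int.cast_zero, add_zero]

theorem sigmaX_zpow_yVar (n : ℤ) : (sigmaX K ^ n) (yVar K) = yVar K := by
  have h : sigmaX K ∈ MulAction.stabilizer (RingAut (BiRat K)) (yVar K) := sigmaX_yVar
  exact (MulAction.stabilizer _ _).zpow_mem h n

theorem sigmaY_zpow_C (n : ℤ) (c : RatFunc K) :
    (sigmaY K ^ n) (RatFunc.C c) = RatFunc.C c := by
  have h : sigmaY K ∈ MulAction.stabilizer (RingAut (BiRat K)) (RatFunc.C c : BiRat K) := sigmaY_C c
  exact (MulAction.stabilizer _ _).zpow_mem h n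

theorem sigmaX_zpow_C_C (n : ℤ) (c : K) :
    (sigmaX K ^ n) (RatFunc.C (RatFunc.C c)) = RatFunc.C (RatFunc.C c) := by
  have h : sigmaX K ∈ MulAction.stabilizer (RingAut (BiRat K))
      (RatFunc.C (RatFunc.C c) : BiRat K) := by
    change sigmaX K _ = _
    rw [sigmaX_C, shiftUni_C]
  exact (MulAction.stabilizer _ _).zpow_mem h n

theorem zpow_apply_of_apply_eq_add_one {R : Type*} [CommRing R] (σ : RingAut R) {v : R}
    (h : σ v = v + 1) (n : ℤ) : (σ ^ n) v = v + n := by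
  have hinv : σ⁻¹ v = v - 1 := by
    change σ.symm v = v - 1
    rw [RingEquiv.symm_apply_eq, map_sub, map_one, h, add_sub_cancel_right]
  induction n using Int.induction_on with
  | zero => simp
  | succ n ih =>
    rw [zpow_add, zpow_one, RingAut.mul_apply, h, map_add, map_one, ih]
    push_cast
    ring
  | pred n ih =>
    rw [zpow_sub, zpow_one, RingAut.mul_apply, hinv, map_sub, map_one, ih]
    push_cast
    ring

theorem sigmaX_zpow_xVar (n : ℤ) : (sigmaX K ^ n) (xVar K) = xVar K + n :=
  zpow_apply_of_apply_eq_add_one _ sigmaX_xVar n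

theorem sigmaY_zpow_yVar (n : ℤ) : (sigmaY K ^ n) (yVar K) = yVar K + n :=
  zpow_apply_of_apply_eq_add_one _ sigmaY_yVar n

/-- The shifts fix K and translate x and y, so the argument λx+μy+n just grows by aλ+bμ. -/
theorem sigma_zpow_linPoly (p : K[X]) (lam mu n a b : ℤ) :
    (sigmaX K ^ a) ((sigmaY K ^ b) (algebraMap (RatFunc K)[X] (BiRat K) (linPoly p lam mu n))) =
      algebraMap (RatFunc K)[X] (BiRat K) (linPoly p lam mu (n + (a * lam + b * mu))) := by
  have hx : (sigmaY K ^ b) (xVar K) = xVar K := sigmaY_zpow_C b _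
  rw [algebraMap_linPoly, algebraMap_linPoly]
  set φ : BiRat K →+* BiRat K := ((sigmaX K ^ a : RingAut (BiRat K)) : BiRat K →+* BiRat K).comp
    ((sigmaY K ^ b : RingAut (BiRat K)) : BiRat K →+* BiRat K) with hφ
  change φ _ = _
  rw [hom_eval₂]
  congr 1
  · ext c
    change (sigmaX K ^ a) ((sigmaY K ^ b) (RatFunc.C (RatFunc.C c))) = _
    rw [sigmaY_zpow_C, sigmaX_zpow_C_C]
    rfl
  · change (sigmaX K ^ a) ((sigmaY K ^ b) _) = _
    simp only [map_add, map_mul, map_intCast, hx, sigmaX_zpow_xVar, sigmaY_zpow_yVar,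
      sigmaX_zpow_yVar]
    push_cast
    ring

theorem shiftPoly_linPoly (p : K[X]) (lam mu n : ℤ) :
    shiftPoly (RatFunc K) (linPoly p lam mu n) = linPoly p lam mu (n + mu) := by
  apply FaithfulSMul.algebraMap_injective (RatFunc K)[X] (BiRat K)
  rw [← shiftUni_algebraMap]
  simpa [sigmaY] using sigma_zpow_linPoly p lam mu n 0 1

/-- Substituting an invertible linear polynomial is an automorphism of the polynomial ring. -/
def compLinear {F : Type*} [Field F] (a b : F) (ha : a ≠ 0) : F[X] ≃ₐ[F] F[X] :=
  AlgEquiv.ofAlgHom (aeval (C a * X + C b)) (aeval (C a⁻¹ * X - C (a⁻¹ * b)))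
    (by
      ext
      simp only [AlgHom.comp_apply, aeval_X, map_sub, map_mul, aeval_C, algebraMap_eq,
        AlgHom.id_apply]
      simp only [mul_add, ← mul_assoc, ← C_mul, inv_mul_cancel₀ ha]
      simp)
    (by
      ext
      simp only [AlgHom.comp_apply, aeval_X, map_add, map_mul, aeval_C, algebraMap_eq,
        AlgHom.id_apply]
      simp only [mul_sub, ← mul_assoc, ← C_mul, mul_inv_cancel₀ ha]
      simp)

theorem compLinear_apply {F : Type*} [Field F] {a b : F} (ha : a ≠ 0) (f : F[X]) :
    compLinear a b ha f = f.comp (C a * X + C b) := by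
  simp [compLinear, comp, aeval_def]

/-- Over K[x], a factorization would specialize at x = 0 to one of `p`; Gauss's lemma then passes to
K(x). Both steps use that `p` is monic. -/
theorem irreducible_map_ratFunc_C {p : K[X]} (hm : p.Monic) (hp : Irreducible p) :
    Irreducible (p.map (RatFunc.C : K →+* RatFunc K)) := by
  have h1 : Irreducible (p.map (C : K →+* K[X])) := by
    refine Monic.irreducible_of_irreducible_map (evalRingHom (0 : K)) _ (hm.map _) ?_
    rw [Polynomial.map_map]
    have : (evalRingHom (0 : K)).comp C = RingHom.id K := by ext; simp
    rwa [this, Polynomial.map_id]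
  have h2 := (Monic.irreducible_iff_irreducible_map_fraction_map (K := RatFunc K)
    (hm.map (C : K →+* K[X]))).mp h1
  rw [Polynomial.map_map] at h2
  convert h2 using 2
  ext c
  simp

/-- By the Bézout relation aλ+bμ = 1, some shift realizes any integer translation of λx+μy. -/
theorem shiftEquiv_of_linPoly_eq {p p' : K[X]} {lam mu n n' : ℤ} (hc : IsCoprime lam mu)
    (h : linPoly p lam mu n = linPoly p' lam mu n') :
    ShiftEquiv (evalLin p lam mu) (evalLin p' lam mu) := by
  obtain ⟨a, b, hab⟩ := hc
  have key : ∀ (q : K[X]) (k l : ℤ), (sigmaX K ^ (a * l)) ((sigmaY K ^ (b * l))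
      (algebraMap (RatFunc K)[X] (BiRat K) (linPoly q lam mu k))) =
      algebraMap (RatFunc K)[X] (BiRat K) (linPoly q lam mu (k + l)) := by
    intro q k l
    rw [sigma_zpow_linPoly]
    congr 3
    linear_combination l * hab
  refine ⟨a * (n' - n), b * (n' - n), ?_⟩
  rw [evalLin_eq_algebraMap, evalLin_eq_algebraMap, key]
  have h1 := key p n (-n)
  rw [h, key, add_neg_cancel] at h1
  rw [← h1]
  congr 2
  ring

variable [CharZero K]

instance : CharZero (RatFunc K) := charZero_of_injective_ringHom (RatFunc.C_injective (K := K))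

/-- In characteristic zero μ is invertible, so the substitution is an automorphism of K(x)[y]. -/
theorem irreducible_linPoly {p : K[X]} (hm : p.Monic) (hp : Irreducible p) (lam : ℤ) {mu : ℤ}
    (hmu : mu ≠ 0) (n : ℤ) : Irreducible (linPoly p lam mu n) := by
  have hmu' : (mu : RatFunc K) ≠ 0 := by exact_mod_cast hmu
  rw [linPoly, ← compLinear_apply hmu']
  exact (MulEquiv.irreducible_iff _).mpr (irreducible_map_ratFunc_C hm hp)

theorem natDegree_linPoly (p : K[X]) (lam : ℤ) {mu : ℤ} (hmu : mu ≠ 0) (n : ℤ) :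
    (linPoly p lam mu n).natDegree = p.natDegree := by
  have hmu' : (mu : RatFunc K) ≠ 0 := by exact_mod_cast hmu
  rw [linPoly, natDegree_comp, natDegree_linear hmu', mul_one, natDegree_map]

theorem leadingCoeff_linPoly {p : K[X]} (hm : p.Monic) (lam : ℤ) {mu : ℤ} (hmu : mu ≠ 0) (n : ℤ) :
    (linPoly p lam mu n).leadingCoeff = (mu : RatFunc K) ^ p.natDegree := by
  have hmu' : (mu : RatFunc K) ≠ 0 := by exact_mod_cast hmu
  rw [linPoly, leadingCoeff_comp (by rw [natDegree_linear hmu']; exact one_ne_zero),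
    leadingCoeff_linear hmu', natDegree_map, (hm.map _).leadingCoeff, one_mul]

/-- The second coefficient of a linear substitution. -/
theorem coeff_comp_linear_natDegree_sub_one {F : Type*} [Field F] {f : F[X]} (hf : f.Monic)
    {d : ℕ} (hd : f.natDegree = d + 1) (a b : F) :
    (f.comp (C a * X + C b)).coeff d = a ^ d * ((d + 1) * b + f.coeff d) := by
  -- Translate by `b`, then scale by `a`: the coefficient becomes a Hasse derivative of order `d` at
  -- `b`, which is affine in `b`.
  have h : f.comp (C a * X + C b) = (taylor b f).comp (C a * X) := by
    rw [taylor_apply, comp_assoc]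
    simp
  rw [h, comp_C_mul_X_coeff, taylor_coeff, mul_comm, eval_eq_sum_range' (n := 2)]
  · simp only [Finset.sum_range_succ, hasseDeriv_coeff, Finset.sum_range_zero]
    have h1 : f.coeff (1 + d) = 1 := by rw [add_comm, ← hd]; exact hf
    rw [h1, add_comm 1 d, zero_add, zero_add, Nat.choose_self, Nat.choose_succ_self_right]
    push_cast
    ring
  · exact (natDegree_hasseDeriv_le f d).trans_lt (by omega)

/-- The two top coefficients in y decide. Eliminating the unit `c` between them leaves an identity
of linear polynomials in x, whose x-coefficient gives μ'λ = μλ'. Coprimality and positivity then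
force (λ,μ) = (λ',μ'), and the leading coefficients give c = 1. -/
theorem associated_linPoly {p p' : K[X]} (hm : p.Monic) (hm' : p'.Monic) (hp : Irreducible p)
    {lam mu lam' mu' : ℤ} (hmu : 0 < mu) (hmu' : 0 < mu') (hc : IsCoprime lam mu)
    (hc' : IsCoprime lam' mu') {n n' : ℤ}
    (h : Associated (linPoly p lam mu n) (linPoly p' lam' mu' n')) :
    lam = lam' ∧ mu = mu' ∧ linPoly p lam mu n = linPoly p' lam' mu' n' := by
  have hmuF : (mu : RatFunc K) ≠ 0 := by exact_mod_cast hmu.ne'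
  have hmuF' : (mu' : RatFunc K) ≠ 0 := by exact_mod_cast hmu'.ne'
  have hdeg : p.natDegree = p'.natDegree := by
    rw [← natDegree_linPoly p lam hmu.ne' n, ← natDegree_linPoly p' lam' hmu'.ne' n']
    exact natDegree_eq_of_degree_eq (degree_eq_degree_of_associated h)
  obtain ⟨u, hu⟩ := h
  obtain ⟨c, hc0, hcu⟩ := isUnit_iff.mp u.isUnit
  rw [← hcu] at hu
  obtain ⟨d, hd⟩ : ∃ d, p.natDegree = d + 1 :=
    Nat.exists_eq_succ_of_ne_zero hp.natDegree_pos.ne'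
  have hlead := congrArg leadingCoeff hu
  rw [leadingCoeff_mul, leadingCoeff_C, leadingCoeff_linPoly hm lam hmu.ne',
    leadingCoeff_linPoly hm' lam' hmu'.ne', ← hdeg, hd] at hlead
  have hnext := congrArg (fun f => f.coeff d) hu
  simp only [coeff_mul_C] at hnext
  rw [linPoly, linPoly, coeff_comp_linear_natDegree_sub_one (hm.map _) (by rw [natDegree_map, hd]),
    coeff_comp_linear_natDegree_sub_one (hm'.map _) (by rw [natDegree_map, ← hdeg, hd])] at hnext
  simp only [coeff_map] at hnext
  -- `hlead` and `hnext` combine so that `c` cancels.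
  have key : (mu' : RatFunc K) * ((d + 1) * (lam * (RatFunc.X : RatFunc K) + n) + RatFunc.C (p.coeff d)) =
      mu * ((d + 1) * (lam' * (RatFunc.X : RatFunc K) + n') + RatFunc.C (p'.coeff d)) := by
    have hpow : (mu' : RatFunc K) ^ d ≠ 0 := pow_ne_zero _ hmuF'
    have hpow' : (mu : RatFunc K) ^ d ≠ 0 := pow_ne_zero _ hmuF
    apply mul_left_cancel₀ hpow
    apply mul_left_cancel₀ hpow'
    linear_combination (-(mu:RatFunc K) ^ d *
      ((d + 1) * (lam * (RatFunc.X : RatFunc K) + n) + RatFunc.C (p.coeff d))) * hlead +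
      (mu : RatFunc K) ^ (d + 1) * hnext
  have key' : (C (mu' : K) * ((d + 1) * (lam * (X : K[X]) + n) + C (p.coeff d)) : K[X]) =
      C (mu : K) * ((d + 1) * (lam' * (X : K[X]) + n') + C (p'.coeff d)) := by
    apply FaithfulSMul.algebraMap_injective K[X] (RatFunc K)
    simpa using key
  have hX := congrArg (fun f => f.coeff 1) key'
  have e : ∀ (m l n : ℤ) (c : K), (C (m : K) * ((d + 1) * (l * (X : K[X]) + n) + C c) : K[X]).coeff 1 =
      m * ((d + 1) * l) := by
    intro m l n c
    have : (C (m : K) * ((d + 1) * (l * (X : K[X]) + n) + C c) : K[X]) =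
        C (m * ((d + 1) * l) : K) * X + C (m * ((d + 1) * n + c) : K) := by
      simp only [C_mul, C_add, map_natCast, map_intCast, map_one]
      ring
    rw [this, coeff_add, coeff_C_mul, coeff_X_one, coeff_C_of_ne_zero one_ne_zero, mul_one, add_zero]
  simp only [e] at hX
  have hcross : mu' * lam = mu * lam' := by
    have hd1 : ((d : K) + 1) ≠ 0 := by exact_mod_cast d.succ_ne_zero
    have : (mu' : K) * lam = mu * lam' := by
      apply mul_left_cancel₀ hd1
      linear_combination hX
    exact_mod_cast this
  -- Each of μ, μ' divides the other, being coprime to its own λ.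
  have hmm : mu = mu' := by
    refine Int.dvd_antisymm hmu.le hmu'.le ?_ ?_
    · exact hc.symm.dvd_of_dvd_mul_right ⟨lam', hcross⟩
    · exact hc'.symm.dvd_of_dvd_mul_right ⟨lam, hcross.symm⟩
  subst hmm
  have hll : lam = lam' := mul_left_cancel₀ hmu.ne' hcross
  subst hll
  have hc1 : c = 1 := by
    have hpow : (mu : RatFunc K) ^ (d + 1) ≠ 0 := pow_ne_zero _ hmuF
    exact mul_left_cancel₀ hpow (by rw [hlead, mul_one])
  rw [hc1, C_1, mul_one] at hu
  exact ⟨rfl, rfl, hu⟩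

/-- The second coefficient in y is affine in n with slope μ^d (d+1), nonzero in characteristic zero.
-/
theorem linPoly_injective {p : K[X]} (hm : p.Monic) (hp : Irreducible p) {lam mu : ℤ}
    (hmu : mu ≠ 0) {n n' : ℤ} (h : linPoly p lam mu n = linPoly p lam mu n') : n = n' := by
  have hmuF : (mu : RatFunc K) ≠ 0 := by exact_mod_cast hmu
  obtain ⟨d, hd⟩ : ∃ d, p.natDegree = d + 1 :=
    Nat.exists_eq_succ_of_ne_zero hp.natDegree_pos.ne'
  have hnext := congrArg (fun f => f.coeff d) h
  rw [linPoly, linPoly, coeff_comp_linear_natDegree_sub_one (hm.map _) (by rw [natDegree_map, hd]),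
    coeff_comp_linear_natDegree_sub_one (hm.map _) (by rw [natDegree_map, hd])] at hnext
  have h1 := mul_left_cancel₀ (pow_ne_zero d hmuF) hnext
  have hd1 : ((d : RatFunc K) + 1) ≠ 0 := by exact_mod_cast d.succ_ne_zero
  have h2 : (n : RatFunc K) = n' := by
    apply mul_left_cancel₀ hd1
    linear_combination h1
  exact_mod_cast h2

end LinearForms

/-! ### Operators, their application, and the product ⊙. -/

section OperatorAction

variable {K : Type*} [Field K]

theorem app_zero_left (f : BiRat K) : app (0 : Op K) f = 0 := SkewMonoidAlgebra.sum_zero_index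

theorem app_add_left (L M : Op K) (f : BiRat K) : app (L + M) f = app L f + app M f :=
  SkewMonoidAlgebra.sum_add_index' (fun _ => zero_mul _) fun _ _ _ => add_mul _ _ _

theorem app_single (s : ShiftGroup) (a f : BiRat K) :
    app (SkewMonoidAlgebra.single s a) f = a * shiftHom K s f :=
  SkewMonoidAlgebra.sum_single_index (zero_mul _)

/-- The application of an operator to `f`, as an additive map in the operator. -/
def appHom (f : BiRat K) : Op K →+ BiRat K where
  toFun L := app L f
  map_zero' := app_zero_left f
  map_add' L M := app_add_left L M f

theorem app_add_right (L : Op K) (f g : BiRat K) : app L (f + g) = app L f + app L g := by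
  simp only [app, map_add, mul_add]
  exact SkewMonoidAlgebra.sum_add _ _ _

theorem app_sum_right {ι : Type*} (L : Op K) (s : Finset ι) (f : ι → BiRat K) :
    app L (∑ i ∈ s, f i) = ∑ i ∈ s, app L (f i) :=
  map_sum (AddMonoidHom.mk' (app L) (app_add_right L)) f s

theorem app_mul (L M : Op K) (f : BiRat K) : app (L * M) f = app L (app M f) := by
  induction L using SkewMonoidAlgebra.induction_on' with
  | add L L' h h' => rw [add_mul, app_add_left, app_add_left, h, h']
  | single s a =>
    induction M using SkewMonoidAlgebra.induction_on' with
    | add M M' h h' => rw [mul_add, app_add_left, app_add_left, app_add_right, h, h']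
    | single t b =>
      rw [SkewMonoidAlgebra.single_mul_single, app_single, app_single, app_single, map_mul, map_mul,
        mul_assoc]
      rfl

theorem app_Sy (f : BiRat K) : app Sy f = sigmaY K f := by
  rw [Sy, app_single]
  simp [shiftHom, mon]

theorem app_one (f : BiRat K) : app (1 : Op K) f = f := by
  rw [SkewMonoidAlgebra.one_def, app_single]
  simp

theorem app_Sy_sub_one (f : BiRat K) : app (Sy - 1) f = sigmaY K f - f := by
  have : app (Sy - 1) f = app Sy f - app 1 f := map_sub (appHom f) _ _
  rw [this, app_Sy, app_one]

theorem lmPhi_zero (lam mu : ℤ) : lmPhi lam mu (0 : Op K) = 0 := SkewMonoidAlgebra.sum_zero_index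

theorem lmPhi_add (lam mu : ℤ) (L M : Op K) :
    lmPhi lam mu (L + M) = lmPhi lam mu L + lmPhi lam mu M :=
  SkewMonoidAlgebra.sum_add_index' (fun _ => SkewMonoidAlgebra.single_zero _)
    fun _ _ _ => SkewMonoidAlgebra.single_add _ _ _

/-- The exponent `iλ + jμ` associated with the monomial `S_x^i S_y^j`. -/
def weight (lam mu : ℤ) (s : ShiftGroup) : ℤ := s.toAdd.1 * lam + s.toAdd.2 * mu

theorem weight_mul (lam mu : ℤ) (s t : ShiftGroup) :
    weight lam mu (s * t) = weight lam mu s + weight lam mu t := by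
  simp only [weight, toAdd_mul, Prod.fst_add, Prod.snd_add]
  ring

/-- S_{λ,μ} has weight αλ+βμ = 1, so the exponent of a power is its weight. -/
theorem weight_lmMon_zpow {lam mu : ℤ} (hc : IsCoprime lam mu) (n : ℤ) :
    weight lam mu (lmMon lam mu ^ n) = n := by
  simp only [weight, lmMon, mon, ← ofAdd_zsmul, toAdd_ofAdd, Prod.smul_mk, smul_eq_mul]
  linear_combination n * bezout hc

theorem lmMon_zpow_injective {lam mu : ℤ} (hc : IsCoprime lam mu) :
    Function.Injective fun n : ℤ => lmMon lam mu ^ n :=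
  Function.LeftInverse.injective (weight_lmMon_zpow hc)

theorem weight_mon (lam mu i j : ℤ) : weight lam mu (mon i j) = i * lam + j * mu := rfl

theorem lmPhi_single (lam mu : ℤ) (s : ShiftGroup) (a : BiRat K) :
    lmPhi lam mu (SkewMonoidAlgebra.single s a) =
      SkewMonoidAlgebra.single (lmMon lam mu ^ weight lam mu s) a :=
  SkewMonoidAlgebra.sum_single_index (SkewMonoidAlgebra.single_zero _)

/-- The additive group of operators all of whose terms `a s` satisfy `s ∈ S` and `a ∈ V`. -/
def termGroup (S : Set ShiftGroup) (V : AddSubgroup (BiRat K)) : AddSubgroup (Op K) where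
  carrier := {L | ∀ s, L.coeff s ∈ V ∧ (s ∉ S → L.coeff s = 0)}
  zero_mem' s := by simp
  add_mem' {L M} hL hM s := by
    rw [SkewMonoidAlgebra.coeff_add, Finsupp.add_apply]
    exact ⟨V.add_mem (hL s).1 (hM s).1, fun h => by rw [(hL s).2 h, (hM s).2 h, add_zero]⟩
  neg_mem' {L} hL s := by
    rw [SkewMonoidAlgebra.coeff_neg, Finsupp.neg_apply]
    exact ⟨V.neg_mem (hL s).1, fun h => by rw [(hL s).2 h, neg_zero]⟩

theorem mem_termGroup {S : Set ShiftGroup} {V : AddSubgroup (BiRat K)} {L : Op K} :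
    L ∈ termGroup S V ↔ ∀ s, L.coeff s ∈ V ∧ (s ∉ S → L.coeff s = 0) := Iff.rfl

theorem single_mem_termGroup {S : Set ShiftGroup} {V : AddSubgroup (BiRat K)} {s : ShiftGroup}
    {a : BiRat K} (hs : s ∈ S) (ha : a ∈ V) : SkewMonoidAlgebra.single s a ∈ termGroup S V := by
  classical
  intro t
  rw [SkewMonoidAlgebra.coeff_single_apply]
  split_ifs with h
  · exact ⟨ha, fun ht => absurd (h ▸ hs) ht⟩
  · exact ⟨V.zero_mem, fun _ => rfl⟩

theorem mem_lmOp_iff {lam mu : ℤ} {L : Op K} :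
    L ∈ lmOp K lam mu ↔ L ∈ termGroup (Set.range fun n : ℤ => lmMon lam mu ^ n) ⊤ := by
  rw [mem_termGroup]
  refine forall_congr' fun s => ?_
  rw [SkewMonoidAlgebra.mem_support_iff]
  simp only [AddSubgroup.mem_top, true_and, Set.mem_range, eq_comm (a := s)]
  exact not_imp_comm

theorem eq_sum_single (L : Op K) :
    L = ∑ s ∈ L.support, SkewMonoidAlgebra.single s (L.coeff s) :=
  (SkewMonoidAlgebra.sum_single L).symm

theorem lmPhi_mem_termGroup (lam mu : ℤ) {V : AddSubgroup (BiRat K)} {L : Op K}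
    (hL : ∀ s, L.coeff s ∈ V) :
    lmPhi lam mu L ∈ termGroup (Set.range fun n : ℤ => lmMon lam mu ^ n) V :=
  AddSubgroup.sum_mem _ fun s _ => single_mem_termGroup ⟨_, rfl⟩ (hL s)

theorem coeff_mul_mem {V : AddSubgroup (BiRat K)} {L M : Op K}
    (h : ∀ s ∈ L.support, ∀ t ∈ M.support, L.coeff s * shiftHom K s (M.coeff t) ∈ V)
    (s : ShiftGroup) : (L * M).coeff s ∈ V := by
  have : L * M ∈ termGroup Set.univ V := by
    rw [SkewMonoidAlgebra.mul_def]
    exact AddSubgroup.sum_mem _ fun s hs => AddSubgroup.sum_mem _ fun t ht =>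
      single_mem_termGroup (Set.mem_univ _) (h s hs t ht)
  exact (this s).1

theorem dot_mem_lmOp (lam mu : ℤ) (L M : Op K) : dot lam mu L M ∈ lmOp K lam mu :=
  mem_lmOp_iff.mpr (lmPhi_mem_termGroup lam mu fun _ => AddSubgroup.mem_top _)

theorem lmOp_ext {lam mu : ℤ} {L M : Op K} (hL : L ∈ lmOp K lam mu) (hM : M ∈ lmOp K lam mu)
    (h : ∀ n : ℤ, L.coeff (lmMon lam mu ^ n) = M.coeff (lmMon lam mu ^ n)) : L = M := by
  rw [mem_lmOp_iff] at hL hM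
  refine SkewMonoidAlgebra.ext fun s => ?_
  by_cases hs : s ∈ Set.range fun n : ℤ => lmMon lam mu ^ n
  · obtain ⟨n, rfl⟩ := hs
    exact h n
  · rw [(hL s).2 hs, (hM s).2 hs]

theorem dot_Sy_sub_one_add (lam mu : ℤ) (Q Q' : Op K) :
    dot lam mu (Sy - 1) (Q + Q') = dot lam mu (Sy - 1) Q + dot lam mu (Sy - 1) Q' := by
  rw [dot, mul_add, lmPhi_add]
  rfl

theorem dot_Sy_sub_one_single {lam mu : ℤ} (hc : IsCoprime lam mu) (n : ℤ) (a : BiRat K) :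
    dot lam mu (Sy - 1) (SkewMonoidAlgebra.single (lmMon lam mu ^ n) a) =
      SkewMonoidAlgebra.single (lmMon lam mu ^ (n + mu)) (sigmaY K a) -
        SkewMonoidAlgebra.single (lmMon lam mu ^ n) a := by
  have hs : mon 0 1 • a = sigmaY K a := by
    change shiftHom K (mon 0 1) a = _
    simp [shiftHom, mon]
  rw [dot, sub_mul, one_mul, sub_eq_add_neg, ← SkewMonoidAlgebra.single_neg, lmPhi_add, Sy,
    SkewMonoidAlgebra.single_mul_single, lmPhi_single, lmPhi_single, weight_mul,
    weight_lmMon_zpow hc, weight_mon, SkewMonoidAlgebra.single_neg, ← sub_eq_add_neg, hs, one_mul,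
    zero_mul, one_mul, zero_add, add_comm mu]

/-- S_y has weight μ, so under φ it raises the exponent of S_{λ,μ} by μ while σ_y acts on the
coefficient. -/
theorem coeff_dot_Sy_sub_one {lam mu : ℤ} (hc : IsCoprime lam mu) {Q : Op K}
    (hQ : Q ∈ lmOp K lam mu) (n : ℤ) :
    (dot lam mu (Sy - 1) Q).coeff (lmMon lam mu ^ n) =
      sigmaY K (Q.coeff (lmMon lam mu ^ (n - mu))) - Q.coeff (lmMon lam mu ^ n) := by
  classical
  -- Induction runs over finite sets of terms so that every monomial remains a power of S_{λ,μ}.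
  have hsum : ∀ (s : Finset ShiftGroup) (a : ShiftGroup → BiRat K),
      (∀ t ∈ s, ∃ k : ℤ, t = lmMon lam mu ^ k) →
      (dot lam mu (Sy - 1) (∑ t ∈ s, SkewMonoidAlgebra.single t (a t))).coeff (lmMon lam mu ^ n) =
        sigmaY K ((∑ t ∈ s, SkewMonoidAlgebra.single t (a t)).coeff (lmMon lam mu ^ (n - mu))) -
          (∑ t ∈ s, SkewMonoidAlgebra.single t (a t)).coeff (lmMon lam mu ^ n) := by
    intro s a hs
    induction s using Finset.induction_on with
    | empty => simp [dot, lmPhi_zero]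
    | insert t s ht ih =>
      obtain ⟨k, rfl⟩ := hs t (Finset.mem_insert_self t s)
      rw [Finset.sum_insert ht, dot_Sy_sub_one_add, SkewMonoidAlgebra.coeff_add, Finsupp.add_apply,
        ih fun t ht => hs t (Finset.mem_insert_of_mem ht), dot_Sy_sub_one_single hc]
      have hk : k + mu = n ↔ k = n - mu := eq_sub_iff_add_eq.symm
      have hinj : ∀ i j : ℤ, lmMon lam mu ^ i = lmMon lam mu ^ j ↔ i = j := fun i j =>
        (lmMon_zpow_injective hc).eq_iff
      simp only [SkewMonoidAlgebra.coeff_add, Finsupp.add_apply, SkewMonoidAlgebra.coeff_sub,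
        Finsupp.sub_apply, SkewMonoidAlgebra.coeff_single_apply, hinj, map_add, hk]
      split_ifs <;> (try simp only [map_zero]) <;> ring
  rw [eq_sum_single Q]
  exact hsum _ _ hQ

theorem shiftHom_evalLin (p : K[X]) (lam mu : ℤ) (s : ShiftGroup) :
    shiftHom K s (evalLin p lam mu) =
      algebraMap (RatFunc K)[X] (BiRat K) (linPoly p lam mu (weight lam mu s)) := by
  rw [evalLin_eq_algebraMap, ← zero_add (weight lam mu s)]
  exact sigma_zpow_linPoly p lam mu 0 _ _

theorem app_lmPhi {lam mu : ℤ} (hc : IsCoprime lam mu) (p : K[X]) (k : ℕ) (L : Op K) :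
    app (lmPhi lam mu L) (1 / evalLin p lam mu ^ k) = app L (1 / evalLin p lam mu ^ k) := by
  induction L using SkewMonoidAlgebra.induction_on' with
  | add L L' h h' => rw [lmPhi_add, app_add_left, app_add_left, h, h']
  | single s a =>
    rw [lmPhi_single, app_single, app_single]
    simp only [map_div₀, map_one, map_pow, shiftHom_evalLin, weight_lmMon_zpow hc]

theorem app_dot {lam mu : ℤ} (hc : IsCoprime lam mu) (p : K[X]) (k : ℕ) (L M : Op K) :
    app (dot lam mu L M) (1 / evalLin p lam mu ^ k) =
      app L (app M (1 / evalLin p lam mu ^ k)) := by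
  rw [dot, app_lmPhi hc, app_mul]

theorem app_inv_evalLin_pow (p : K[X]) (lam mu : ℤ) (k : ℕ) (N : Op K) :
    app N (1 / evalLin p lam mu ^ k) = ∑ s ∈ N.support, N.coeff s /
      algebraMap (RatFunc K)[X] (BiRat K) (linPoly p lam mu (weight lam mu s)) ^ k := by
  change ∑ s ∈ N.support, N.coeff s * shiftHom K s _ = _
  refine Finset.sum_congr rfl fun s _ => ?_
  rw [map_div₀, map_one, map_pow, shiftHom_evalLin, mul_one_div]

/-- This direction needs no degree bound and no inequivalence of the denominators. -/
theorem sum_app_eq_shift_sub {m : ℕ} {d : Fin m → ℕ} {lam mu : Fin m → ℤ} {p : Fin m → K[X]}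
    {N Q : Fin m → ℕ → Op K} (hcop : ∀ i, IsCoprime (lam i) (mu i))
    (h : ∀ i, ∀ k ∈ Finset.Icc 1 (d i), N i k = dot (lam i) (mu i) (Sy - 1) (Q i k)) :
    ∑ i, ∑ k ∈ Finset.Icc 1 (d i), app (N i k) (1 / evalLin (p i) (lam i) (mu i) ^ k) =
      app (Sy - 1)
        (∑ i, ∑ k ∈ Finset.Icc 1 (d i), app (Q i k) (1 / evalLin (p i) (lam i) (mu i) ^ k)) := by
  simp only [app_sum_right]
  refine Finset.sum_congr rfl fun i _ => Finset.sum_congr rfl fun k hk => ?_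
  rw [h i k hk, app_dot (hcop i)]

/-- The additive group of the `a ∈ K(x)[y]` of degree less than `d`. -/
def lowDegree (K : Type*) [Field K] (d : ℕ) : AddSubgroup (BiRat K) :=
  (degreeLT (RatFunc K) d).toAddSubgroup.map
    (algebraMap (RatFunc K)[X] (BiRat K)).toAddMonoidHom

theorem mem_lowDegree {d : ℕ} {f : BiRat K} : f ∈ lowDegree K d ↔
    ∃ a : (RatFunc K)[X], a.degree < d ∧ algebraMap (RatFunc K)[X] (BiRat K) a = f := by
  simp [lowDegree, AddSubgroup.mem_map, mem_degreeLT]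

theorem C_mul_mem_lowDegree {d : ℕ} {f : BiRat K} (hf : f ∈ lowDegree K d) (c : RatFunc K) :
    RatFunc.C c * f ∈ lowDegree K d := by
  obtain ⟨a, ha, rfl⟩ := mem_lowDegree.mp hf
  refine mem_lowDegree.mpr ⟨C c * a, ?_, by rw [map_mul, RatFunc.algebraMap_C]⟩
  rw [← smul_eq_C_mul]
  exact (degree_smul_le c a).trans_lt ha

theorem sigmaX_pow_mem_lowDegree {d : ℕ} {f : BiRat K} (hf : f ∈ lowDegree K d) (n : ℕ) :
    (sigmaX K ^ n) f ∈ lowDegree K d := by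
  induction n with
  | zero => simpa using hf
  | succ n ih =>
    rw [pow_succ', RingAut.mul_apply]
    obtain ⟨a, ha, h⟩ := mem_lowDegree.mp ih
    refine mem_lowDegree.mpr ⟨mapEquiv (shiftUni K) a, ?_, ?_⟩
    · simpa [mapEquiv] using ha
    · rw [← h, sigmaX, IsFractionRing.ringEquivOfRingEquiv_algebraMap]

/-- Operators in K[x][S_x] act on coefficients by σ_x and by factors free of y, neither of which
raises the y-degree; φ merely adds coefficients together. -/
theorem coeff_dot_mem_lowDegree {lam mu : ℤ} {d : ℕ} {L M : Op K} (hL : L ∈ polyOpX K)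
    (hM : M ∈ lmPolyOp K lam mu d) (s : ShiftGroup) :
    (dot lam mu L M).coeff s ∈ lowDegree K d := by
  refine (lmPhi_mem_termGroup lam mu (coeff_mul_mem fun s hs t ht => ?_) s).1
  obtain ⟨⟨n, rfl⟩, c, hc⟩ := hL s hs
  obtain ⟨-, a, ha, hat⟩ := hM t ht
  rw [hc]
  refine C_mul_mem_lowDegree ?_ _
  have : shiftHom K (mon n 0) = sigmaX K ^ n := by simp [shiftHom, mon]
  rw [this]
  exact sigmaX_pow_mem_lowDegree (mem_lowDegree.mpr ⟨a, ha, hat.symm⟩) n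

end OperatorAction

/-! ### Reading operators off partial fraction numerators. -/

section Residues

variable {K : Type*} [Field K] [CharZero K]

theorem fracCoeff_lowDegree_self {p : K[X]} (hm : p.Monic) (hp : Irreducible p) (lam : ℤ) {mu : ℤ}
    (hmu : mu ≠ 0) (n : ℤ) (j : ℕ) {a : BiRat K} (ha : a ∈ lowDegree K p.natDegree) :
    fracCoeff (linPoly p lam mu n) j
      (a / algebraMap (RatFunc K)[X] (BiRat K) (linPoly p lam mu n) ^ (j + 1)) = a := by
  obtain ⟨a, ha, rfl⟩ := mem_lowDegree.mp ha
  have hq := irreducible_linPoly hm hp lam hmu n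
  refine fracCoeff_div_pow_self hq ?_ j
  rwa [degree_eq_natDegree hq.ne_zero, natDegree_linPoly p lam hmu]

theorem fracCoeff_lowDegree_of_ne {p : K[X]} (hm : p.Monic) (hp : Irreducible p) (lam : ℤ) {mu : ℤ}
    (hmu : mu ≠ 0) (n : ℤ) {q : (RatFunc K)[X]} (hq0 : q ≠ 0) {j j' : ℕ}
    (h : ¬ (Associated q (linPoly p lam mu n) ∧ j = j'))
    {a : BiRat K} (ha : a ∈ lowDegree K p.natDegree) :
    fracCoeff q j
      (a / algebraMap (RatFunc K)[X] (BiRat K) (linPoly p lam mu n) ^ (j' + 1)) = 0 := by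
  obtain ⟨a, ha, rfl⟩ := mem_lowDegree.mp ha
  have hq := irreducible_linPoly hm hp lam hmu n
  refine fracCoeff_div_pow_of_ne hq0 hq ?_ h
  rwa [degree_eq_natDegree hq.ne_zero, natDegree_linPoly p lam hmu]

theorem fracCoeff_app_of_ne {p : K[X]} (hm : p.Monic) (hp : Irreducible p) {lam mu : ℤ}
    (hmu : mu ≠ 0) {q : (RatFunc K)[X]} (hq0 : q ≠ 0) {j j' : ℕ}
    (h : ∀ n, ¬ (Associated q (linPoly p lam mu n) ∧ j = j')) {N : Op K}
    (hN : ∀ s, N.coeff s ∈ lowDegree K p.natDegree) :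
    fracCoeff q j (app N (1 / evalLin p lam mu ^ (j' + 1))) = 0 := by
  rw [app_inv_evalLin_pow, map_sum]
  exact Finset.sum_eq_zero fun s _ => fracCoeff_lowDegree_of_ne hm hp lam hmu _ hq0 (h _) (hN s)

/-- Distinct powers of S_{λ,μ} yield non-associated denominators, so only the term with exponent n
contributes. -/
theorem fracCoeff_app_self {p : K[X]} (hm : p.Monic) (hp : Irreducible p) {lam mu : ℤ}
    (hc : IsCoprime lam mu) (hmu : 0 < mu) (n : ℤ) (j : ℕ) {N : Op K} (hNl : N ∈ lmOp K lam mu)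
    (hN : ∀ s, N.coeff s ∈ lowDegree K p.natDegree) :
    fracCoeff (linPoly p lam mu n) j (app N (1 / evalLin p lam mu ^ (j + 1))) =
      N.coeff (lmMon lam mu ^ n) := by
  rw [app_inv_evalLin_pow, map_sum, Finset.sum_eq_single (lmMon lam mu ^ n)]
  · rw [weight_lmMon_zpow hc]
    exact fracCoeff_lowDegree_self hm hp lam hmu.ne' n j (hN _)
  · intro s hs hsn
    obtain ⟨n', rfl⟩ := hNl s hs
    rw [weight_lmMon_zpow hc]
    refine fracCoeff_lowDegree_of_ne hm hp lam hmu.ne' n'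
      (irreducible_linPoly hm hp lam hmu.ne' n).ne_zero (fun h => hsn ?_) (hN _)
    rw [linPoly_injective hm hp hmu.ne' (associated_linPoly hm hm hp hmu hmu hc hc h.1).2.2]
  · intro hs
    rw [SkewMonoidAlgebra.notMem_support_iff.mp hs, zero_div, map_zero]

/-- If a sum of fractions with numerators of low degree is `σ_y`-summable, then so is each of the
operators that describe it. -/
theorem exists_dot_eq_of_sum_app_eq {m : ℕ} {d : Fin m → ℕ} {lam mu : Fin m → ℤ}
    {p : Fin m → K[X]} {N : Fin m → ℕ → Op K}
    (hcop : ∀ i, IsCoprime (lam i) (mu i)) (hmu : ∀ i, 0 < mu i)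
    (hmonic : ∀ i, (p i).Monic) (hirr : ∀ i, Irreducible (p i))
    (hinequiv : ∀ i j, i ≠ j →
      ¬ ShiftEquiv (evalLin (p i) (lam i) (mu i)) (evalLin (p j) (lam j) (mu j)))
    (hNl : ∀ i, ∀ k ∈ Finset.Icc 1 (d i), N i k ∈ lmOp K (lam i) (mu i))
    (hN : ∀ i, ∀ k ∈ Finset.Icc 1 (d i), ∀ s, (N i k).coeff s ∈ lowDegree K (p i).natDegree)
    {g : BiRat K} (hg : ∑ i, ∑ k ∈ Finset.Icc 1 (d i),
      app (N i k) (1 / evalLin (p i) (lam i) (mu i) ^ k) = sigmaY K g - g)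
    (i : Fin m) {k : ℕ} (hk : k ∈ Finset.Icc 1 (d i)) :
    ∃ Q ∈ lmOp K (lam i) (mu i), N i k = dot (lam i) (mu i) (Sy - 1) Q := by
  classical
  -- `fracCoeff` with index `j` refers to the power `j + 1`.
  obtain ⟨j, rfl⟩ : ∃ j, k = j + 1 :=
    Nat.exists_eq_succ_of_ne_zero (Nat.one_le_iff_ne_zero.mp (Finset.mem_Icc.mp hk).1)
  set P : ℤ → (RatFunc K)[X] := linPoly (p i) (lam i) (mu i) with hP
  have hP0 : ∀ n, P n ≠ 0 := fun n =>
    (irreducible_linPoly (hmonic i) (hirr i) (lam i) (hmu i).ne' n).ne_zero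
  have hcoeff : ∀ n, (N i (j + 1)).coeff (lmMon (lam i) (mu i) ^ n) =
      fracCoeff (P n) j (sigmaY K g - g) := by
    intro n
    rw [← hg, map_sum, Finset.sum_eq_single i, map_sum, Finset.sum_eq_single (j + 1),
      fracCoeff_app_self (hmonic i) (hirr i) (hcop i) (hmu i) n j (hNl i _ hk) (hN i _ hk)]
    · intro k' hk' hne
      obtain ⟨j', rfl⟩ : ∃ j, k' = j + 1 :=
        Nat.exists_eq_succ_of_ne_zero (Nat.one_le_iff_ne_zero.mp (Finset.mem_Icc.mp hk').1)
      exact fracCoeff_app_of_ne (hmonic i) (hirr i) (hmu i).ne' (hP0 n)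
        (fun n' h => hne (by rw [h.2])) (hN i _ hk')
    · exact fun h => absurd hk h
    -- An associated denominator from another index would share (λ,μ) and be an integer translate,
    -- contradicting shift-inequivalence.
    · intro i' _ hne
      rw [map_sum]
      refine Finset.sum_eq_zero fun k' hk' => ?_
      obtain ⟨j', rfl⟩ : ∃ j, k' = j + 1 :=
        Nat.exists_eq_succ_of_ne_zero (Nat.one_le_iff_ne_zero.mp (Finset.mem_Icc.mp hk').1)
      refine fracCoeff_app_of_ne (hmonic i') (hirr i') (hmu i').ne' (hP0 n)
        (fun n' h => hinequiv i i' hne.symm ?_) (hN i' _ hk')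
      obtain ⟨h1, h2, h3⟩ := associated_linPoly (hmonic i) (hmonic i') (hirr i) (hmu i) (hmu i')
        (hcop i) (hcop i') h.1
      rw [← h1, ← h2] at h3 ⊢
      exact shiftEquiv_of_linPoly_eq (hcop i) h3
    · exact fun h => absurd (Finset.mem_univ i) h
  have hfin := finite_fracCoeff_ne_zero P hP0 (fun n n' h =>
    linPoly_injective (hmonic i) (hirr i) (hmu i).ne' (associated_linPoly (hmonic i) (hmonic i)
      (hirr i) (hmu i) (hmu i) (hcop i) (hcop i) h).2.2) j g
  -- The coefficients of the witness are the numerators of `g` along the orbit of denominators `P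
  -- n`.
  set Q : Op K := ∑ n ∈ hfin.toFinset,
    SkewMonoidAlgebra.single (lmMon (lam i) (mu i) ^ n) (fracCoeff (P n) j g) with hQ
  have hQl : Q ∈ lmOp K (lam i) (mu i) := mem_lmOp_iff.mpr <|
    AddSubgroup.sum_mem _ fun n _ => single_mem_termGroup ⟨n, rfl⟩ (AddSubgroup.mem_top _)
  have hQc : ∀ n, Q.coeff (lmMon (lam i) (mu i) ^ n) = fracCoeff (P n) j g := by
    intro n
    have hcoe : ∀ s : ShiftGroup, Q.coeff s = ∑ n ∈ hfin.toFinset,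
        (SkewMonoidAlgebra.single (lmMon (lam i) (mu i) ^ n) (fracCoeff (P n) j g)).coeff s := by
      intro s
      exact map_sum ((Finsupp.applyAddHom s).comp
        (SkewMonoidAlgebra.coeffAddEquiv (k := BiRat K) (G := ShiftGroup)).toAddMonoidHom) _ _
    rw [hcoe]
    simp only [SkewMonoidAlgebra.coeff_single_apply, (lmMon_zpow_injective (hcop i)).eq_iff]
    rw [Finset.sum_ite_eq']
    split_ifs with h
    · rfl
    · by_contra hne
      exact h (hfin.mem_toFinset.mpr fun h0 => hne h0.symm)
  refine ⟨Q, hQl, lmOp_ext (hNl i _ hk) (dot_mem_lmOp _ _ _ _) fun n => ?_⟩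
  -- Both sides agree because σ_y carries `P (n - mu i)` to `P n`.
  rw [hcoeff, coeff_dot_Sy_sub_one (hcop i) hQl, hQc, hQc, map_sub, sigmaY, ← fracCoeff_shift,
    hP, shiftPoly_linPoly, sub_add_cancel]

end Residues

end

end Telescoping

/-! ### The criterion for telescopers. -/

open Telescoping in
theorem theorem4p2 {K : Type*} [Field K] [CharZero K]
    (m : ℕ) (d : Fin m → ℕ) (lam mu : Fin m → ℤ) (p : Fin m → Polynomial K)
    (M : Fin m → ℕ → Op K)
    (hcop : ∀ i, IsCoprime (lam i) (mu i)) (hmu : ∀ i, 0 < mu i)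
    (hmonic : ∀ i, (p i).Monic) (hirr : ∀ i, Irreducible (p i))
    (hinequiv : ∀ i j, i ≠ j →
      ¬ ShiftEquiv (evalLin (p i) (lam i) (mu i)) (evalLin (p j) (lam j) (mu j)))
    (hM : ∀ i, ∀ k ∈ Finset.Icc 1 (d i), M i k ∈ lmPolyOp K (lam i) (mu i) (p i).natDegree)
    (r : BiRat K)
    (hr : r = ∑ i, ∑ k ∈ Finset.Icc 1 (d i),
      app (M i k) (1 / evalLin (p i) (lam i) (mu i) ^ k))
    (L : Op K) (hL : L ∈ polyOpX K) (hL0 : L ≠ 0) :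
    (IsTelescoper L r ↔
      ∀ i, ∀ k ∈ Finset.Icc 1 (d i), ∃ Q ∈ lmOp K (lam i) (mu i),
        dot (lam i) (mu i) L (M i k) = dot (lam i) (mu i) (Sy - 1) Q) ∧
    (∀ Q : Fin m → ℕ → Op K,
      (∀ i, ∀ k ∈ Finset.Icc 1 (d i), Q i k ∈ lmOp K (lam i) (mu i) ∧
        dot (lam i) (mu i) L (M i k) = dot (lam i) (mu i) (Sy - 1) (Q i k)) →
      IsCertificate L r (∑ i, ∑ k ∈ Finset.Icc 1 (d i),
        app (Q i k) (1 / evalLin (p i) (lam i) (mu i) ^ k))) := by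
  have hLr : app L r = ∑ i, ∑ k ∈ Finset.Icc 1 (d i),
      app (dot (lam i) (mu i) L (M i k)) (1 / evalLin (p i) (lam i) (mu i) ^ k) := by
    rw [hr]
    simp only [app_sum_right]
    exact Finset.sum_congr rfl fun i _ => Finset.sum_congr rfl fun k _ =>
      (app_dot (hcop i) _ _ _ _).symm
  have hcert : ∀ Q : Fin m → ℕ → Op K,
      (∀ i, ∀ k ∈ Finset.Icc 1 (d i), Q i k ∈ lmOp K (lam i) (mu i) ∧
        dot (lam i) (mu i) L (M i k) = dot (lam i) (mu i) (Sy - 1) (Q i k)) →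
      IsCertificate L r (∑ i, ∑ k ∈ Finset.Icc 1 (d i),
        app (Q i k) (1 / evalLin (p i) (lam i) (mu i) ^ k)) := fun Q hQ => by
    rw [IsCertificate, hLr]
    exact sum_app_eq_shift_sub hcop fun i k hk => (hQ i k hk).2
  refine ⟨⟨?_, fun h => ⟨hL, hL0, ?_⟩⟩, hcert⟩
  · rintro ⟨-, -, g, hg⟩ i k hk
    rw [IsCertificate, hLr, app_Sy_sub_one] at hg
    exact exists_dot_eq_of_sum_app_eq hcop hmu hmonic hirr hinequiv
      (fun i k _ => dot_mem_lmOp _ _ _ _)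
      (fun i k hk => coeff_dot_mem_lowDegree hL (hM i k hk)) hg i hk
  -- The values of `Q i k` for `k` outside the range are arbitrary and never enter the sum.
  · choose! Q hQ using h
    exact ⟨_, hcert Q hQ⟩
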